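/- Let $d,n\ge 1$ and let $\mathcal S\subset\{0,1\}^d$ be almost symmetric of order $k\in\{1,\dots,d\}$, i.e. $\sum_{i=1}^d v_i\le k$ for all $v\in\mathcal S$ and $\mathrm{Conv}(\mathcal S)\cap[\frac{k}{2d},1]^d\ne\emptyset$. Put $\mathcal L=\max(\log(d/k),1)$. In each round $t=1,\dots,n$ of the semi-bandit game the forecaster draws an action $V_t\in\mathcal S$, while the adversary simultaneously (without knowing $V_t$, but possibly depending on the past and on its own randomization) selects a loss vector $\ell_t\in[0,\infty)^d$; the forecaster then observes only the coordinates $\ell_{i,t}$ with $V_{i,t}=1$. The regret is $$\overline R_n=\mathbb E\sum_{t=1}^n\ell_t^TV_t-\min_{v\in\mathcal S}\mathbb E\sum_{t=1}^n\ell_t^Tv .$$ For $\eta>0$ let $F(u)=\frac1\eta\sum_{i=1}^d u_i\log u_i$ on $[0,\infty)^d$ (with $0\log 0=0$) and $D_F(u,v)=F(u)-F(v)-(u-v)^T\nabla F(v)$. Semi-bandit linexp with parameter $\eta$ is the following forecaster. It starts from $w_1=\operatorname{argmin}_{w\in\mathrm{Conv}(\mathcal S)}D_F\big(w,(\frac kd,\dots,\frac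 kd)^T\big)$. In round $t$ it draws $V_t$ from a distribution $p_t$ on $\mathcal S$ (any choice depending on its past observations) with $\mathbb E_{V\sim p_t}V=w_t$, sets $\tilde\ell_{i,t}=\ell_{i,t}V_{i,t}/w_{i,t}$, lets $w'_{t+1}\in(0,\infty)^d$ satisfy $\nabla F(w'_{t+1})=\nabla F(w_t)-\tilde\ell_t$, and takes $w_{t+1}\in\operatorname{argmin}_{w\in\mathrm{Conv}(\mathcal S)\cap(0,\infty)^d}D_F(w,w'_{t+1})$. Then: - if $\|\ell_t\|_\infty\le 1$ for all $t$ ($L_\infty$ assumption), linexp with $\eta=\sqrt{\frac{2k\mathcal L}{nd}}$ satisfies $\overline R_n\le\sqrt{2knd\mathcal L}$; - if $\ell_t^Tv\le 1$ for all $t$ and all $v\in\mathcal S$ ($L_2$ assumption), linexp with $\eta=k\sqrt{\frac{\mathcal L}{nd}}$ satisfies $\overline R_n\le 2\sqrt{nd\mathcal L}$. -/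

import Mathlib

open MeasureTheory Finset
open scoped BigOperators Matrix

noncomputable section

/-! ### Almost symmetric action sets -/

/-- The finite set `S` of vectors is contained in `{0,1}^d` and is almost symmetric of order `k`:
`k ∈ {1,…,d}`, every action has at most `k` ones, and
`Conv(S) ∩ [k/(2d), 1]^d` is nonempty. -/
def IsAlmostSymmetric {d : ℕ} (S : Finset (Fin d → ℝ)) (k : ℕ) : Prop :=
  (∀ v ∈ S, ∀ i, v i = 0 ∨ v i = 1) ∧
  1 ≤ k ∧ k ≤ d ∧
  (∀ v ∈ S, ∑ i, v i ≤ (k : ℝ)) ∧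
  (convexHull ℝ (S : Set (Fin d → ℝ)) ∩
    {z | ∀ i, (k : ℝ) / (2 * (d : ℝ)) ≤ z i ∧ z i ≤ 1}).Nonempty

/-! ### The semi-bandit game

Rounds are numbered `0, 1, …, n - 1`. -/

/-- What the forecaster sees of the loss vector `l` in the semi-bandit game after playing `v`:
the coordinates `l i` with `v i = 1` (the other coordinates are replaced by `0`). -/
def semiBanditObs {d : ℕ} (l v : Fin d → ℝ) : Fin d → ℝ :=
  fun i => if v i = 1 then l i else 0

/-- The information available to the forecaster at the beginning of round `t`: for each earlier
round, the pair (action played, observed coordinates of the loss vector). -/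
abbrev SemiBanditHistory (d t : ℕ) : Type :=
  Fin t → (Fin d → ℝ) × (Fin d → ℝ)

/-- Histories that can occur in the semi-bandit game with action set `S` and nonnegative losses. -/
def IsAdmissibleHistory {d t : ℕ} (S : Finset (Fin d → ℝ)) (h : SemiBanditHistory d t) : Prop :=
  ∀ s, (h s).1 ∈ S ∧ ∃ l : Fin d → ℝ, (∀ i, 0 ≤ l i) ∧ (h s).2 = semiBanditObs l (h s).1

/-- A (randomized) forecaster for the semi-bandit game: to each round `t` and each history it
assigns a probability distribution `v ↦ prob t h v` on the action set `S`, measurably in the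
history. -/
structure SemiBanditForecaster {d : ℕ} (S : Finset (Fin d → ℝ)) where
  prob : (t : ℕ) → SemiBanditHistory d t → (Fin d → ℝ) → ℝ
  prob_nonneg : ∀ t h, ∀ v ∈ S, 0 ≤ prob t h v
  prob_sum : ∀ t h, ∑ v ∈ S, prob t h v = 1
  prob_measurable : ∀ t, ∀ v ∈ S, Measurable fun h => prob t h v

/-- The mean action `w_t = E_{V ∼ p_t} V` of the forecaster at round `t` after history `h`. -/
def SemiBanditForecaster.mean {d : ℕ} {S : Finset (Fin d → ℝ)} (σ : SemiBanditForecaster S)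
    (t : ℕ) (h : SemiBanditHistory d t) : Fin d → ℝ :=
  fun i => ∑ v ∈ S, σ.prob t h v * v i

/-- The history at the beginning of round `t` generated by the losses `ℓ` and the actions `V`. -/
def semiBanditHistory {d : ℕ} {Ω : Type*} (ℓ V : ℕ → Ω → Fin d → ℝ) (t : ℕ) (ω : Ω) :
    SemiBanditHistory d t :=
  fun s => (V s ω, semiBanditObs (ℓ s ω) (V s ω))

/-- The random losses `ℓ` and actions `V` are a play of `n` rounds of the semi-bandit game by the
forecaster `σ` against some (possibly randomized and adaptive) adversary. The σ-algebra `𝓖 t`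
contains everything that is determined before `V t` is drawn, including all the past and the loss
vector `ℓ t`, which the adversary selects without knowing `V t`; given `𝓖 t`, the action `V t` has
the law that the forecaster prescribes after the history that it has observed. -/
structure IsSemiBanditPlay {d : ℕ} {Ω : Type*} {mΩ : MeasurableSpace Ω} (P : Measure Ω)
    (𝓖 : Filtration ℕ mΩ) {S : Finset (Fin d → ℝ)} (σ : SemiBanditForecaster S) (n : ℕ)
    (ℓ V : ℕ → Ω → Fin d → ℝ) : Prop where
  loss_measurable : ∀ t < n, Measurable[𝓖 t] (ℓ t)
  loss_nonneg : ∀ t < n, ∀ ω i, 0 ≤ ℓ t ω i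
  action_measurable : ∀ t < n, Measurable[𝓖 (t + 1)] (V t)
  action_mem : ∀ t < n, ∀ ω, V t ω ∈ S
  action_law : ∀ t < n, ∀ v ∈ S,
    P[Set.indicator {ω | V t ω = v} (fun _ => (1 : ℝ)) | 𝓖 t]
      =ᵐ[P] fun ω => σ.prob t (semiBanditHistory ℓ V t ω) v

/-- The regret
`E ∑_t ℓ_tᵀ V_t - min_{v ∈ S} E ∑_t ℓ_tᵀ v` over `n` rounds. -/
def expectedRegret {d : ℕ} {Ω : Type*} {mΩ : MeasurableSpace Ω} (P : Measure Ω)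
    (S : Finset (Fin d → ℝ)) (n : ℕ) (ℓ V : ℕ → Ω → Fin d → ℝ) : ℝ :=
  (∫ ω, ∑ t ∈ range n, ℓ t ω ⬝ᵥ V t ω ∂P) -
    ⨅ v : {v // v ∈ S}, ∫ ω, ∑ t ∈ range n, ℓ t ω ⬝ᵥ (v : Fin d → ℝ) ∂P

/-- The `L_∞` assumption: `‖ℓ_t‖_∞ ≤ 1` in every round (the norm of `Fin d → ℝ` is the
sup norm). -/
def LInftyAssumption {d : ℕ} {Ω : Type*} (n : ℕ) (ℓ : ℕ → Ω → Fin d → ℝ) : Prop :=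
  ∀ t < n, ∀ ω, ‖ℓ t ω‖ ≤ 1

/-- The `L_2` assumption: `ℓ_tᵀ v ≤ 1` in every round, for every action `v ∈ S`. -/
def LTwoAssumption {d : ℕ} {Ω : Type*} (S : Finset (Fin d → ℝ)) (n : ℕ)
    (ℓ : ℕ → Ω → Fin d → ℝ) : Prop :=
  ∀ t < n, ∀ ω, ∀ v ∈ S, ℓ t ω ⬝ᵥ v ≤ 1

/-! ### CLEB and LINEXP -/

/-- The gradient of `F`, as the vector of its partial derivatives. -/
def grad {d : ℕ} (F : (Fin d → ℝ) → ℝ) (v : Fin d → ℝ) : Fin d → ℝ :=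
  fun i => fderiv ℝ F v (Pi.single i 1)

/-- The Bregman divergence `D_F(u, v) = F(u) - F(v) - (u - v)ᵀ ∇F(v)`. -/
def bregman {d : ℕ} (F : (Fin d → ℝ) → ℝ) (u v : Fin d → ℝ) : ℝ :=
  F u - F v - (u - v) ⬝ᵥ grad F v

/-- `w` is a minimizer of `f` over `A`, that is `w ∈ argmin_A f`. -/
def IsArgmin {E : Type*} (f : E → ℝ) (A : Set E) (w : E) : Prop :=
  w ∈ A ∧ ∀ u ∈ A, f w ≤ f u

/-- The semi-bandit loss estimate `ℓ̃_i = ℓ_i V_i / w_i`, computed from the action `r.1 = V`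
and the observed coordinates `r.2` of the loss vector `ℓ`. -/
def semiBanditEstimate {d : ℕ} (w : Fin d → ℝ) (r : (Fin d → ℝ) × (Fin d → ℝ)) : Fin d → ℝ :=
  fun i => r.2 i * (r.1 i / w i)

/-- The forecaster `σ` follows, during `n` rounds, the strategy CLEB (combinatorial learning with
Bregman projections) for the function `F` on the domain `D`, started from `w₁`, with the semi-bandit
loss estimate. Its distribution in the first round has mean `w₁`, and after an admissible
history its distribution has as mean a Bregman projection on `Conv(S) ∩ Int(D)` of a point
`w' ∈ Int(D)` with `∇F(w') = ∇F(w_t) - ℓ̃_t`. The choice of a distribution with the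
prescribed mean is free. -/
def IsSemiBanditCleb {d : ℕ} {S : Finset (Fin d → ℝ)} (F : (Fin d → ℝ) → ℝ)
    (D : Set (Fin d → ℝ)) (w₁ : Fin d → ℝ) (n : ℕ) (σ : SemiBanditForecaster S) : Prop :=
  (∀ h : SemiBanditHistory d 0, σ.mean 0 h = w₁) ∧
  ∀ t, t + 1 < n → ∀ h : SemiBanditHistory d (t + 1), IsAdmissibleHistory S h →
    ∃ w' ∈ interior D,
      grad F w' = grad F (σ.mean t (Fin.init h)) -
        semiBanditEstimate (σ.mean t (Fin.init h)) (h (Fin.last t)) ∧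
      IsArgmin (fun w => bregman F w w')
        (convexHull ℝ (S : Set (Fin d → ℝ)) ∩ interior D) (σ.mean (t + 1) h)

/-- The function `u ↦ (1/η) ∑ u_i log u_i` (with `0 log 0 = 0`). -/
def linexpPotential {d : ℕ} (η : ℝ) (u : Fin d → ℝ) : ℝ :=
  1 / η * ∑ i, u i * Real.log (u i)

/-- Semi-bandit LINEXP with parameter `η`, started from `w₁`: CLEB on `D = [0, ∞)^d` with the
function `(1/η) ∑ u_i log u_i`. -/
def IsSemiBanditLinexp {d : ℕ} {S : Finset (Fin d → ℝ)} (η : ℝ) (w₁ : Fin d → ℝ) (n : ℕ)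
    (σ : SemiBanditForecaster S) : Prop :=
  IsSemiBanditCleb (linexpPotential η) {u | ∀ i, 0 ≤ u i} w₁ n σ

end

open Filter Topology

/-! ### The generalized Kullback-Leibler divergence -/

/-! Up to the factor `1 / η`, the Bregman divergence of the potential is the generalized KL
divergence (`bregman_linexpPotential`), and the gradient equation makes `w'` the multiplicative
update `w_i * exp (-η * l_i)`, with `l` the estimated loss. For a fixed action `v`, one update pays
for the linear regret by a drop of `genKL v ·` plus `η ^ 2 / 2 * ∑ w_i * l_i ^ 2`
(`genKL_multiplicative_step`), and the projection does not increase `genKL v ·`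
(`genKL_le_of_isMin_segment`). Telescoping gives `multiplicative_regret_bound`, whose initial
divergence is at most `k * max (log (d / k)) 1` (`IsAlmostSymmetric.genKL_le`).

In expectation, the estimate `ℓ_i * V_i / w_i` is unbiased. Since `V_i ^ 2 = V_i`, the quadratic
term is `ℓ_i ^ 2 * V_i / w_i`, which is again importance weighted and has the expectation of `ℓ_i ^
2`. With `∑ ℓ_i ^ 2 ≤ B` the regret is at most `k * L / η + η * n * B / 2`, where `B = d` under the
`L_∞` assumption and `B = 2 * d / k` under the `L_2` assumption. The prescribed `η` equates the two
terms. -/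

/-- The generalized Kullback-Leibler divergence `∑ (u_i log (u_i / v_i) - u_i + v_i)`. -/
noncomputable def genKL {d : ℕ} (u v : Fin d → ℝ) : ℝ :=
  ∑ i, (u i * Real.log (u i) - u i * Real.log (v i) - u i + v i)

/-- This is `log s ≤ s - 1` at `s = y / x`, multiplied by `x`; the boundary point `x = 0` is
separate. -/
theorem mul_log_sub_nonneg {x y : ℝ} (hx : 0 ≤ x) (hy : 0 < y) :
    0 ≤ x * Real.log x - x * Real.log y - x + y := by
  rcases hx.eq_or_lt with rfl | hx
  · simp [hy.le]
  · have h := Real.log_le_sub_one_of_pos (div_pos hy hx)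
    rw [Real.log_div hy.ne' hx.ne'] at h
    have h2 := mul_le_mul_of_nonneg_left h hx.le
    have h3 : x * (y / x - 1) = y - x := by field_simp
    rw [h3] at h2
    linarith

theorem genKL_nonneg {d : ℕ} {u v : Fin d → ℝ} (hu : ∀ i, 0 ≤ u i) (hv : ∀ i, 0 < v i) :
    0 ≤ genKL u v :=
  Finset.sum_nonneg fun i _ => mul_log_sub_nonneg (hu i) (hv i)

theorem grad_linexpPotential {d : ℕ} (η : ℝ) {v : Fin d → ℝ} (hv : ∀ i, 0 < v i) :
    grad (linexpPotential η) v = fun i => 1 / η * (Real.log (v i) + 1) := by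
  have h : HasFDerivAt (linexpPotential η)
      ((1 / η) • ∑ i, (Real.log (v i) + 1) •
        (ContinuousLinearMap.proj i : (Fin d → ℝ) →L[ℝ] ℝ)) v := by
    refine HasFDerivAt.const_mul ?_ _
    refine HasFDerivAt.fun_sum fun i _ => ?_
    have hi : HasFDerivAt (fun u : Fin d → ℝ => u i)
        (ContinuousLinearMap.proj i : (Fin d → ℝ) →L[ℝ] ℝ) v := hasFDerivAt_apply i v
    exact (Real.hasDerivAt_mul_log (hv i).ne').comp_hasFDerivAt v hi
  funext i
  rw [grad, h.fderiv]
  simp [Pi.single_apply]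

theorem bregman_linexpPotential {d : ℕ} (η : ℝ) (u : Fin d → ℝ) {v : Fin d → ℝ}
    (hv : ∀ i, 0 < v i) :
    bregman (linexpPotential η) u v = 1 / η * genKL u v := by
  rw [bregman, grad_linexpPotential η hv, linexpPotential, linexpPotential, genKL, dotProduct,
    ← mul_sub, ← Finset.sum_sub_distrib, Finset.mul_sum, Finset.mul_sum,
    ← Finset.sum_sub_distrib]
  refine Finset.sum_congr rfl fun i _ => ?_
  simp only [Pi.sub_apply]
  ring

theorem interior_setOf_nonneg (d : ℕ) :
    interior {u : Fin d → ℝ | ∀ i, 0 ≤ u i} = {u | ∀ i, 0 < u i} := by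
  have h : {u : Fin d → ℝ | ∀ i, 0 ≤ u i} = Set.pi Set.univ fun _ => Set.Ici (0 : ℝ) := by
    ext u; simp [Pi.le_def]
  rw [h, interior_pi_set Set.finite_univ]
  ext u; simp

/-- A purely algebraic identity, so no positivity is needed. It yields both the optimality condition
and the Pythagorean inequality. -/
theorem genKL_three_point {d : ℕ} (u w y : Fin d → ℝ) :
    genKL u y - genKL u w - genKL w y = ∑ i, (u i - w i) * (Real.log (w i) - Real.log (y i)) := by
  simp only [genKL, ← Finset.sum_sub_distrib]
  exact Finset.sum_congr rfl fun i _ => by ring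

/-- First-order optimality of a point `w` that minimizes `genKL · y` on a segment from `w` to `v`. -/
theorem genKL_optimality {d : ℕ} {v w : Fin d → ℝ} (y : Fin d → ℝ) (hv : ∀ i, 0 ≤ v i)
    (hw : ∀ i, 0 < w i)
    (hmin : ∀ s : ℝ, 0 < s → s < 1 → genKL w y ≤ genKL (w + s • (v - w)) y) :
    0 ≤ ∑ i, (v i - w i) * (Real.log (w i) - Real.log (y i)) := by
  have hlim : Tendsto (fun s : ℝ =>
      ∑ i, (v i - w i) * (Real.log (w i + s * (v i - w i)) - Real.log (y i))) (𝓝[>] 0)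
      (𝓝 (∑ i, (v i - w i) * (Real.log (w i) - Real.log (y i)))) := by
    refine tendsto_nhdsWithin_of_tendsto_nhds ?_
    refine tendsto_finsetSum _ fun i _ => ?_
    refine Tendsto.const_mul _ (Tendsto.sub_const ?_ _)
    have hc : ContinuousAt (fun s : ℝ => Real.log (w i + s * (v i - w i))) 0 :=
      ContinuousAt.log (by fun_prop) (by simpa using (hw i).ne')
    simpa [ContinuousAt] using hc
  refine ge_of_tendsto hlim ?_
  filter_upwards [Ioo_mem_nhdsGT (zero_lt_one' ℝ)] with s hs
  have hpos : ∀ i, 0 < w i + s * (v i - w i) := fun i => by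
    have h1 := mul_pos (sub_pos.2 hs.2) (hw i)
    have h2 := mul_nonneg hs.1.le (hv i)
    nlinarith
  have h0 := hmin s hs.1 hs.2
  -- The three-point identity replaces differentiation: minimality and `genKL w (w + s • (v - w)) ≥
  -- 0` fix the sign of the sum at each small `s`, and then `s → 0+`.
  have h1 := genKL_three_point w (w + s • (v - w)) y
  have h2 : 0 ≤ genKL w (w + s • (v - w)) :=
    genKL_nonneg (fun i => (hw i).le) (fun i => by simpa using hpos i)
  have h3 : ∑ i, (w i - (w + s • (v - w)) i) *
      (Real.log ((w + s • (v - w)) i) - Real.log (y i)) =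
      -(s * ∑ i, (v i - w i) * (Real.log (w i + s * (v i - w i)) - Real.log (y i))) := by
    rw [Finset.mul_sum, ← Finset.sum_neg_distrib]
    refine Finset.sum_congr rfl fun i _ => ?_
    simp only [Pi.add_apply, Pi.smul_apply, Pi.sub_apply, smul_eq_mul]
    ring
  rw [h3] at h1
  have h4 : 0 ≤ s * ∑ i, (v i - w i) * (Real.log (w i + s * (v i - w i)) - Real.log (y i)) := by
    linarith
  exact nonneg_of_mul_nonneg_right h4 hs.1

/-- The generalized Pythagorean inequality for projections of positive points. -/
theorem genKL_le_of_isMin_segment {d : ℕ} {v w y : Fin d → ℝ} (hv : ∀ i, 0 ≤ v i)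
    (hw : ∀ i, 0 < w i) (hy : ∀ i, 0 < y i)
    (hmin : ∀ s : ℝ, 0 < s → s < 1 → genKL w y ≤ genKL (w + s • (v - w)) y) :
    genKL v w ≤ genKL v y := by
  have h1 := genKL_optimality y hv hw hmin
  have h2 := genKL_three_point v w y
  have h3 := genKL_nonneg (fun i => (hw i).le) hy
  linarith

theorem mul_log_convex_combination {x z s : ℝ} (hx : 0 ≤ x) (hz : 0 ≤ z) (hs : 0 ≤ s)
    (hs1 : s ≤ 1) :
    (x + s * (z - x)) * Real.log (x + s * (z - x)) ≤
      x * Real.log x + s * (z * Real.log z - x * Real.log x) := by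
  have h := Real.convexOn_mul_log.2 (Set.mem_Ici.2 hx) (Set.mem_Ici.2 hz) (sub_nonneg.2 hs1) hs
    (by ring)
  simp only [smul_eq_mul] at h
  have e : (1 - s) * x + s * z = x + s * (z - x) := by ring
  rw [e] at h
  linarith

/-- A minimizer of `genKL · y` over segments towards a positive point is positive. -/
theorem pos_of_isMin_segment {d : ℕ} {z w : Fin d → ℝ} (y : Fin d → ℝ) (hz : ∀ i, 0 < z i)
    (hw : ∀ i, 0 ≤ w i)
    (hmin : ∀ s : ℝ, 0 < s → s < 1 → genKL w y ≤ genKL (w + s • (z - w)) y) (i : Fin d) :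
    0 < w i := by
  by_contra hcon
  have hwi : w i = 0 := le_antisymm (not_lt.1 hcon) (hw i)
  set C := genKL z y - genKL w y with hC
  -- The slope of `x log x` at `0` is `-∞`. By convexity a step `s` towards `z` changes the
  -- divergence by at most `s * (C + log s * z i)`; this `s` makes the bracket `C - |C| - 1 < 0`.
  set s := Real.exp (-(|C| + 1) / z i) with hs
  have hs0 : 0 < s := Real.exp_pos _
  have hlog : Real.log s * z i = -(|C| + 1) := by
    rw [hs, Real.log_exp, div_mul_cancel₀ _ (hz i).ne']
  have hs1 : s < 1 := by
    rw [hs, Real.exp_lt_one_iff]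
    exact div_neg_of_neg_of_pos (by linarith [abs_nonneg C]) (hz i)
  have h0 := hmin s hs0 hs1
  have hstep : genKL (w + s • (z - w)) y ≤ genKL w y + s * C + s * (Real.log s * z i) := by
    have hsum : s * (Real.log s * z i) = ∑ j, if j = i then s * (Real.log s * z i) else 0 := by
      simp
    rw [hsum, hC]
    simp only [genKL]
    rw [← Finset.sum_sub_distrib, Finset.mul_sum, ← Finset.sum_add_distrib,
      ← Finset.sum_add_distrib]
    refine Finset.sum_le_sum fun j _ => ?_
    simp only [Pi.add_apply, Pi.smul_apply, Pi.sub_apply, smul_eq_mul]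
    split_ifs with hj
    · subst hj
      rw [hwi]
      have : Real.log (s * z j) = Real.log s + Real.log (z j) :=
        Real.log_mul hs0.ne' (hz j).ne'
      simp only [sub_zero, zero_add, this]
      apply le_of_eq
      ring
    · have := mul_log_convex_combination (hw j) (hz j).le hs0.le hs1.le
      linarith
  rw [hlog] at hstep
  have h1 : s * C < s * (|C| + 1) := by
    have := le_abs_self C
    gcongr
    linarith
  linarith

/-! ### Multiplicative updates and their deterministic regret. -/

/-- The product `(1 - x + x ^ 2 / 2) * (1 + x + x ^ 2 / 2)` equals `1 + x ^ 4 / 4`, and the second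
factor is at most `exp x`. -/
theorem exp_neg_le_quadratic {x : ℝ} (hx : 0 ≤ x) : Real.exp (-x) ≤ 1 - x + x ^ 2 / 2 := by
  have h := Real.quadratic_le_exp_of_nonneg hx
  have h1 : 0 < 1 - x + x ^ 2 / 2 := by nlinarith [sq_nonneg (x - 1)]
  have h2 : Real.exp (-x) * Real.exp x = 1 := by rw [← Real.exp_add]; simp
  have h3 : 1 ≤ (1 - x + x ^ 2 / 2) * Real.exp x := by
    calc (1 : ℝ) ≤ (1 - x + x ^ 2 / 2) * (1 + x + x ^ 2 / 2) := by
          nlinarith [sq_nonneg (x ^ 2)]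
      _ ≤ _ := by gcongr
  exact le_of_mul_le_mul_right (h2.le.trans h3) (Real.exp_pos x)

/-- One round of the multiplicative update. -/
theorem genKL_multiplicative_step {d : ℕ} {η : ℝ} (hη : 0 ≤ η) (v : Fin d → ℝ)
    {w l : Fin d → ℝ} (hw : ∀ i, 0 < w i) (hl : ∀ i, 0 ≤ l i) :
    ∑ i, η * (l i * (w i - v i)) ≤
      genKL v w - genKL v (fun i => w i * Real.exp (-(η * l i))) +
        ∑ i, η ^ 2 / 2 * (w i * l i ^ 2) := by
  simp only [genKL]
  rw [← Finset.sum_sub_distrib, ← Finset.sum_add_distrib]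
  refine Finset.sum_le_sum fun i _ => ?_
  rw [Real.log_mul (hw i).ne' (Real.exp_pos _).ne', Real.log_exp]
  have h := mul_le_mul_of_nonneg_left (exp_neg_le_quadratic (mul_nonneg hη (hl i))) (hw i).le
  linarith

/-- The deterministic regret bound for multiplicative updates followed by projections. -/
theorem multiplicative_regret_bound {d : ℕ} {η : ℝ} (hη : 0 ≤ η) {v : Fin d → ℝ}
    (hv : ∀ i, 0 ≤ v i) {n : ℕ} (hn : 1 ≤ n) {w l : ℕ → Fin d → ℝ}
    (hw : ∀ t < n, ∀ i, 0 < w t i) (hl : ∀ t < n, ∀ i, 0 ≤ l t i)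
    (hproj : ∀ t, t + 1 < n →
      genKL v (w (t + 1)) ≤ genKL v (fun i => w t i * Real.exp (-(η * l t i)))) :
    ∑ t ∈ range n, ∑ i, η * (l t i * (w t i - v i)) ≤
      genKL v (w 0) + ∑ t ∈ range n, ∑ i, η ^ 2 / 2 * (w t i * l t i ^ 2) := by
  have key : ∀ m < n, ∑ t ∈ range m, ∑ i, η * (l t i * (w t i - v i)) ≤
      genKL v (w 0) - genKL v (w m) +
        ∑ t ∈ range m, ∑ i, η ^ 2 / 2 * (w t i * l t i ^ 2) := by
    intro m
    induction m with
    | zero => simp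
    | succ m ih =>
      intro hm
      have hmn : m < n := by omega
      rw [Finset.sum_range_succ, Finset.sum_range_succ]
      have h1 := ih hmn
      have h2 := genKL_multiplicative_step hη v (hw m hmn) (hl m hmn)
      have h3 := hproj m hm
      linarith
  -- No projection follows the last round, so there the divergence from the unprojected point is
  -- dropped by nonnegativity.
  obtain ⟨m, rfl⟩ : ∃ m, n = m + 1 := ⟨n - 1, by omega⟩
  have hm : m < m + 1 := Nat.lt_succ_self m
  rw [Finset.sum_range_succ, Finset.sum_range_succ]
  have h1 := key m hm
  have h2 := genKL_multiplicative_step hη v (hw m hm) (hl m hm)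
  have h3 : 0 ≤ genKL v (fun i => w m i * Real.exp (-(η * l m i))) :=
    genKL_nonneg hv fun i => mul_pos (hw m hm i) (Real.exp_pos _)
  linarith

/-! ### Almost symmetric sets -/

section AlmostSymmetric

variable {d k : ℕ} {S : Finset (Fin d → ℝ)}

theorem IsAlmostSymmetric.convexHull_nonneg (hS : IsAlmostSymmetric S k) {w : Fin d → ℝ}
    (hw : w ∈ convexHull ℝ (S : Set (Fin d → ℝ))) (i : Fin d) : 0 ≤ w i := by
  have h : convexHull ℝ (S : Set (Fin d → ℝ)) ⊆ Set.Ici 0 :=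
    convexHull_min (fun v hv i => by rcases hS.1 v hv i with h | h <;> simp [h]) (convex_Ici 0)
  exact h hw i

theorem IsAlmostSymmetric.exists_pos (hS : IsAlmostSymmetric S k) :
    ∃ z ∈ convexHull ℝ (S : Set (Fin d → ℝ)),
      (∀ i, (k : ℝ) / (2 * d) ≤ z i) ∧ ∀ i, 0 < z i := by
  obtain ⟨-, hk, hkd, -, z, hz, hz'⟩ := hS
  have hkd' : (0 : ℝ) < k / (2 * d) := by
    have : (0 : ℝ) < k := by exact_mod_cast hk
    have : (0 : ℝ) < d := by exact_mod_cast hk.trans hkd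
    positivity
  exact ⟨z, hz, fun i => (hz' i).1, fun i => hkd'.trans_le (hz' i).1⟩

theorem IsAlmostSymmetric.nonempty (hS : IsAlmostSymmetric S k) : S.Nonempty := by
  obtain ⟨z, hz, -⟩ := hS.exists_pos
  have h : (convexHull ℝ (S : Set (Fin d → ℝ))).Nonempty := ⟨z, hz⟩
  simpa using convexHull_nonempty_iff.1 h

theorem dotProduct_le_of_mem_convexHull {l z : Fin d → ℝ} {c : ℝ} (h : ∀ v ∈ S, l ⬝ᵥ v ≤ c)
    (hz : z ∈ convexHull ℝ (S : Set (Fin d → ℝ))) : l ⬝ᵥ z ≤ c := by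
  have hsub : convexHull ℝ (S : Set (Fin d → ℝ)) ⊆ {u | l ⬝ᵥ u ≤ c} := by
    refine convexHull_min (fun v hv => h v hv) ?_
    refine convex_halfSpace_le ⟨fun u v => dotProduct_add l u v, fun a u => ?_⟩ c
    exact dotProduct_smul a l u
  exact hsub hz

/-- Otherwise coordinate `i` would vanish on the whole convex hull, which contains a strictly
positive point. -/
theorem IsAlmostSymmetric.exists_eq_one (hS : IsAlmostSymmetric S k) (i : Fin d) :
    ∃ v ∈ S, v i = 1 := by
  by_contra! hcon
  obtain ⟨z, hz, -, hpos⟩ := hS.exists_pos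
  have h := dotProduct_le_of_mem_convexHull (l := Pi.single i 1) (c := 0) (fun v hv => by
    rcases hS.1 v hv i with h | h
    · simp [h]
    · exact absurd h (hcon v hv)) hz
  simp only [single_dotProduct, one_mul] at h
  exact absurd (hpos i) (not_lt.2 h)

theorem IsAlmostSymmetric.loss_le_one (hS : IsAlmostSymmetric S k) {l : Fin d → ℝ}
    (hl : ∀ i, 0 ≤ l i) (h : ∀ v ∈ S, l ⬝ᵥ v ≤ 1) (i : Fin d) : l i ≤ 1 := by
  obtain ⟨v, hv, hvi⟩ := hS.exists_eq_one i
  refine le_trans ?_ (h v hv)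
  have h1 : l i * v i ≤ ∑ j, l j * v j :=
    Finset.single_le_sum (f := fun j => l j * v j)
      (fun j _ => mul_nonneg (hl j) (by rcases hS.1 v hv j with h | h <;> simp [h]))
      (Finset.mem_univ i)
  simpa [hvi, dotProduct] using h1

/-- The bound `l ⬝ᵥ z ≤ 1` extends to a hull point `z` with all coordinates at least `k / (2 * d)`,
which bounds `∑ l i`; finally `l i ^ 2 ≤ l i` because `l i ≤ 1`. -/
theorem IsAlmostSymmetric.sum_sq_loss_le (hS : IsAlmostSymmetric S k) {l : Fin d → ℝ}
    (hl : ∀ i, 0 ≤ l i) (h : ∀ v ∈ S, l ⬝ᵥ v ≤ 1) : ∑ i, l i ^ 2 ≤ 2 * d / k := by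
  obtain ⟨z, hz, hzk, -⟩ := hS.exists_pos
  have hk : (0 : ℝ) < k := by exact_mod_cast hS.2.1
  have hd : (0 : ℝ) < d := by exact_mod_cast hS.2.1.trans hS.2.2.1
  have h1 : ∑ i, l i * (k / (2 * d)) ≤ 1 :=
    (Finset.sum_le_sum fun i _ => mul_le_mul_of_nonneg_left (hzk i) (hl i)).trans
      (dotProduct_le_of_mem_convexHull h hz)
  rw [← Finset.sum_mul] at h1
  have h2 : ∑ i, l i ≤ 2 * d / k := by
    rw [le_div_iff₀ hk]
    have h3 : (∑ i, l i) * (k / (2 * d)) = (∑ i, l i) * k / (2 * d) := by ring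
    rw [h3, div_le_one (by positivity)] at h1
    exact h1
  refine le_trans (Finset.sum_le_sum fun i _ => ?_) h2
  have := mul_le_mul_of_nonneg_left (hS.loss_le_one hl h i) (hl i)
  nlinarith

theorem IsAlmostSymmetric.genKL_le (hS : IsAlmostSymmetric S k) {v : Fin d → ℝ} (hv : v ∈ S) :
    genKL v (fun _ => (k : ℝ) / d) ≤ k * max (Real.log ((d : ℝ) / k)) 1 := by
  have hk : (0 : ℝ) < k := by exact_mod_cast hS.2.1
  have hd : (0 : ℝ) < d := by exact_mod_cast hS.2.1.trans hS.2.2.1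
  have hlog : Real.log ((k : ℝ) / d) = -Real.log ((d : ℝ) / k) := by
    rw [← Real.log_inv, inv_div]
  have h1 : genKL v (fun _ => (k : ℝ) / d) = (∑ i, v i) * (Real.log ((d : ℝ) / k) - 1) + k := by
    have h2 : (k : ℝ) = ∑ _i : Fin d, (k : ℝ) / d := by
      simp only [Finset.sum_const, Finset.card_univ, Fintype.card_fin, nsmul_eq_mul]
      field_simp
    rw [genKL, Finset.sum_mul]
    conv_rhs => rw [h2]
    rw [← Finset.sum_add_distrib]
    refine Finset.sum_congr rfl fun i _ => ?_
    have h3 : v i * Real.log (v i) = 0 := by rcases hS.1 v hv i with h | h <;> simp [h]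
    rw [h3, hlog, ← h2]
    ring
  have h0 : 0 ≤ ∑ i, v i := Finset.sum_nonneg fun i _ =>
    hS.convexHull_nonneg (subset_convexHull ℝ _ hv) i
  have hle := hS.2.2.2.1 v hv
  rw [h1]
  -- The maximum with `1` makes the coefficient of `∑ v i` nonnegative, so that `∑ v i ≤ k` can be
  -- used.
  calc (∑ i, v i) * (Real.log ((d : ℝ) / k) - 1) + k
      ≤ (∑ i, v i) * (max (Real.log ((d : ℝ) / k)) 1 - 1) + k := by
        gcongr; exact le_max_left _ _
    _ ≤ k * (max (Real.log ((d : ℝ) / k)) 1 - 1) + k := by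
        gcongr; linarith [le_max_right (Real.log ((d : ℝ) / k)) 1]
    _ = _ := by ring

end AlmostSymmetric

/-! ### The means of linexp -/

section Linexp

variable {d k n : ℕ} {S : Finset (Fin d → ℝ)} {σ : SemiBanditForecaster S} {η : ℝ}
  {w₁ : Fin d → ℝ}

theorem genKL_le_of_bregman_le (hη : 0 < η) {u w y : Fin d → ℝ} (hy : ∀ i, 0 < y i)
    (h : bregman (linexpPotential η) w y ≤ bregman (linexpPotential η) u y) :
    genKL w y ≤ genKL u y := by
  rw [bregman_linexpPotential η _ hy, bregman_linexpPotential η _ hy] at h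
  exact le_of_mul_le_mul_left h (by positivity)

/-- Needed for the starting point only: it minimizes over the full hull, boundary included, while
the later projections are confined to the open orthant by definition. -/
theorem IsAlmostSymmetric.pos_of_isArgmin (hS : IsAlmostSymmetric S k) (hη : 0 < η)
    {y : Fin d → ℝ} (hy : ∀ i, 0 < y i)
    (h : IsArgmin (fun w => bregman (linexpPotential η) w y)
      (convexHull ℝ (S : Set (Fin d → ℝ))) w₁) (i : Fin d) : 0 < w₁ i := by
  obtain ⟨z, hz, -, hpos⟩ := hS.exists_pos
  refine pos_of_isMin_segment y hpos (hS.convexHull_nonneg h.1) (fun s hs hs1 => ?_) i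
  exact genKL_le_of_bregman_le hη hy
    (h.2 _ ((convex_convexHull ℝ _).add_smul_sub_mem h.1 hz ⟨hs.le, hs1.le⟩))

theorem IsAlmostSymmetric.genKL_le_of_isArgmin (hS : IsAlmostSymmetric S k) (hη : 0 < η)
    {y v : Fin d → ℝ} (hy : ∀ i, 0 < y i) (hv : v ∈ S)
    (h : IsArgmin (fun w => bregman (linexpPotential η) w y)
      (convexHull ℝ (S : Set (Fin d → ℝ))) w₁) : genKL v w₁ ≤ genKL v y := by
  have hvS := subset_convexHull ℝ (S : Set (Fin d → ℝ)) hv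
  refine genKL_le_of_isMin_segment (hS.convexHull_nonneg hvS) (hS.pos_of_isArgmin hη hy h) hy
    fun s hs hs1 => ?_
  exact genKL_le_of_bregman_le hη hy
    (h.2 _ ((convex_convexHull ℝ _).add_smul_sub_mem h.1 hvS ⟨hs.le, hs1.le⟩))

theorem IsSemiBanditLinexp.mean_pos (hσ : IsSemiBanditLinexp η w₁ n σ) (hw₁ : ∀ i, 0 < w₁ i)
    {t : ℕ} (ht : t < n) {h : SemiBanditHistory d t} (hh : IsAdmissibleHistory S h) (i : Fin d) :
    0 < σ.mean t h i := by
  cases t with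
  | zero => rw [hσ.1 h]; exact hw₁ i
  | succ t =>
    obtain ⟨w', -, -, hmem, -⟩ := hσ.2 t ht h hh
    have := hmem.2
    rw [interior_setOf_nonneg] at this
    exact this i

theorem IsAdmissibleHistory.init {t : ℕ} {h : SemiBanditHistory d (t + 1)}
    (hh : IsAdmissibleHistory S h) :
    IsAdmissibleHistory S (Fin.init h : SemiBanditHistory d t) := fun s => hh s.castSucc

/-- The projection step of linexp does not increase the divergence from an action. -/
theorem IsSemiBanditLinexp.genKL_mean_succ_le (hσ : IsSemiBanditLinexp η w₁ n σ) (hη : 0 < η)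
    (hS : IsAlmostSymmetric S k) (hw₁ : ∀ i, 0 < w₁ i) {v : Fin d → ℝ} (hv : v ∈ S) {t : ℕ}
    (ht : t + 1 < n) {h : SemiBanditHistory d (t + 1)} (hh : IsAdmissibleHistory S h) :
    genKL v (σ.mean (t + 1) h) ≤ genKL v (fun i => σ.mean t (Fin.init h) i *
      Real.exp (-(η * semiBanditEstimate (σ.mean t (Fin.init h)) (h (Fin.last t)) i))) := by
  have hpos := hσ.mean_pos hw₁ (Nat.lt_of_succ_lt ht) hh.init
  have hpos' := hσ.mean_pos hw₁ ht hh
  obtain ⟨w', hw', hgrad, hmem, hmin⟩ := hσ.2 t ht h hh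
  rw [interior_setOf_nonneg] at hw' hmem hmin
  have hupd : (fun i => σ.mean t (Fin.init h) i *
      Real.exp (-(η * semiBanditEstimate (σ.mean t (Fin.init h)) (h (Fin.last t)) i))) = w' := by
    funext i
    have hi := congrFun hgrad i
    rw [grad_linexpPotential η hw', grad_linexpPotential η hpos, Pi.sub_apply] at hi
    have hlog : Real.log (w' i) = Real.log (σ.mean t (Fin.init h) i) +
        -(η * semiBanditEstimate (σ.mean t (Fin.init h)) (h (Fin.last t)) i) := by
      field_simp at hi
      linarith
    rw [← Real.exp_log (hw' i), hlog, Real.exp_add, Real.exp_log (hpos i)]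
  rw [hupd]
  have hvS := subset_convexHull ℝ (S : Set (Fin d → ℝ)) hv
  have hv0 := hS.convexHull_nonneg hvS
  refine genKL_le_of_isMin_segment hv0 hpos' hw' fun s hs hs1 => ?_
  refine genKL_le_of_bregman_le hη hw' (hmin _ ⟨?_, fun i => ?_⟩)
  · exact (convex_convexHull ℝ _).add_smul_sub_mem hmem.1 hvS ⟨hs.le, hs1.le⟩
  · simp only [Pi.add_apply, Pi.smul_apply, Pi.sub_apply, smul_eq_mul]
    nlinarith [mul_pos (sub_pos.2 hs1) (hpos' i), mul_nonneg hs.le (hv0 i)]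

end Linexp

/-! ### Importance weighting -/

section ImportanceWeighting

variable {Ω : Type*} {m mΩ : MeasurableSpace Ω} {P : Measure Ω}

/-- Pulling a nonnegative factor out of a conditional expectation, when only the resulting product
is known to be integrable. -/
theorem integrable_mul_and_integral_mul_of_condExp [IsFiniteMeasure P]
    (hm : m ≤ mΩ) {f q g : Ω → ℝ} (hf : Integrable f P) (hfm : Measurable f)
    (hf0 : ∀ ω, 0 ≤ f ω) (hqm : Measurable q) (hq0 : ∀ ω, 0 ≤ q ω) (hq : P[f | m] =ᵐ[P] q)
    (hg : Measurable[m] g) (hg0 : ∀ ω, 0 ≤ g ω) (hgq : Integrable (fun ω => g ω * q ω) P) :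
    Integrable (fun ω => g ω * f ω) P ∧ ∫ ω, g ω * f ω ∂P = ∫ ω, g ω * q ω ∂P := by
  have hqi : Integrable q P := integrable_condExp.congr hq
  -- The densities `f` and `q` define the same measure on `m`, so every nonnegative `m`-measurable
  -- `g` has the same lower integral against both, with no integrability assumed.
  have htrim : (P.withDensity fun ω => ENNReal.ofReal (f ω)).trim hm =
      (P.withDensity fun ω => ENNReal.ofReal (q ω)).trim hm := by
    refine @Measure.ext _ m _ _ fun s hs => ?_
    rw [trim_measurableSet_eq hm hs, trim_measurableSet_eq hm hs, withDensity_apply _ (hm s hs),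
      withDensity_apply _ (hm s hs),
      ← ofReal_integral_eq_lintegral_ofReal hf.integrableOn (ae_of_all _ hf0),
      ← ofReal_integral_eq_lintegral_ofReal hqi.integrableOn (ae_of_all _ hq0),
      ← setIntegral_condExp hm hf hs,
      setIntegral_congr_ae (hm s hs) (hq.mono fun ω h _ => h)]
  have hgm : Measurable g := hg.mono hm le_rfl
  have hg' : Measurable[m] fun ω => ENNReal.ofReal (g ω) := ENNReal.measurable_ofReal.comp hg
  have hlin : ∫⁻ ω, ENNReal.ofReal (g ω * f ω) ∂P = ∫⁻ ω, ENNReal.ofReal (g ω * q ω) ∂P := by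
    have hrw : ∀ r : Ω → ℝ, Measurable r → ∫⁻ ω, ENNReal.ofReal (g ω * r ω) ∂P =
        ∫⁻ ω, ENNReal.ofReal (g ω) ∂(P.withDensity fun ω => ENNReal.ofReal (r ω)) := by
      intro r hr
      rw [lintegral_withDensity_eq_lintegral_mul _ hr.ennreal_ofReal hgm.ennreal_ofReal]
      refine lintegral_congr fun ω => ?_
      rw [Pi.mul_apply, mul_comm, ENNReal.ofReal_mul' (hg0 ω)]
    rw [hrw f hfm, hrw q hqm, ← lintegral_trim hm hg', htrim, lintegral_trim hm hg']
  have hint : Integrable (fun ω => g ω * f ω) P := by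
    refine ⟨(hgm.mul hfm).aestronglyMeasurable, ?_⟩
    rw [hasFiniteIntegral_iff_ofReal (ae_of_all _ fun ω => mul_nonneg (hg0 ω) (hf0 ω)), hlin,
      ← hasFiniteIntegral_iff_ofReal (ae_of_all _ fun ω => mul_nonneg (hg0 ω) (hq0 ω))]
    exact hgq.2
  refine ⟨hint, ?_⟩
  rw [integral_eq_lintegral_of_nonneg_ae (ae_of_all _ fun ω => mul_nonneg (hg0 ω) (hf0 ω)) hint.1,
    integral_eq_lintegral_of_nonneg_ae (ae_of_all _ fun ω => mul_nonneg (hg0 ω) (hq0 ω)) hgq.1,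
    hlin]

/-- The importance-weighted estimate of a bounded nonnegative quantity is unbiased. -/
theorem integrable_and_integral_importance_weighted [IsFiniteMeasure P]
    (hm : m ≤ mΩ) {d : ℕ} {S : Finset (Fin d → ℝ)} {V : Ω → Fin d → ℝ} {p : (Fin d → ℝ) → Ω → ℝ}
    {w g : Ω → ℝ} {i : Fin d} {C : ℝ} (hS : ∀ v ∈ S, 0 ≤ v i) (hV : Measurable V)
    (hVS : ∀ ω, V ω ∈ S) (hpm : ∀ v ∈ S, Measurable[m] (p v)) (hp0 : ∀ v ∈ S, ∀ ω, 0 ≤ p v ω)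
    (hlaw : ∀ v ∈ S, P[Set.indicator {ω | V ω = v} (fun _ => (1 : ℝ)) | m] =ᵐ[P] p v)
    (hw : ∀ ω, w ω = ∑ v ∈ S, p v ω * v i) (hw0 : ∀ ω, 0 < w ω) (hg : Measurable[m] g)
    (hg0 : ∀ ω, 0 ≤ g ω) (hgC : ∀ ω, g ω ≤ C) :
    Integrable (fun ω => g ω * (V ω i / w ω)) P ∧
      ∫ ω, g ω * (V ω i / w ω) ∂P = ∫ ω, g ω ∂P := by
  have hwm : Measurable[m] w := by
    rw [funext hw]
    exact Finset.measurable_fun_sum _ fun v hv => (hpm v hv).mul_const _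
  have hGm : ∀ v : Fin d → ℝ, Measurable[m] fun ω => g ω * (v i / w ω) := fun v =>
    hg.mul (hwm.const_div (v i))
  have hG0 : ∀ v ∈ S, ∀ ω, 0 ≤ g ω * (v i / w ω) := fun v hv ω =>
    mul_nonneg (hg0 ω) (div_nonneg (hS v hv) (hw0 ω).le)
  have hGp : ∀ v ∈ S, Integrable (fun ω => g ω * (v i / w ω) * p v ω) P := by
    intro v hv
    -- Although `1 / w` may be unbounded, `p v * v i` is one of the nonnegative terms summing to
    -- `w`, so the ratio is at most `1`.
    refine Integrable.of_bound (((hGm v).mul (hpm v hv)).mono hm le_rfl).aestronglyMeasurable C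
      (ae_of_all _ fun ω => ?_)
    rw [Real.norm_of_nonneg (mul_nonneg (hG0 v hv ω) (hp0 v hv ω))]
    refine le_trans ?_ (hgC ω)
    rw [mul_assoc]
    refine mul_le_of_le_one_right (hg0 ω) ?_
    rw [div_mul_eq_mul_div, div_le_one (hw0 ω), hw ω, mul_comm]
    exact Finset.single_le_sum (f := fun v : Fin d → ℝ => p v ω * v i)
      (fun u hu => mul_nonneg (hp0 u hu ω) (hS u hu)) hv
  have hset : ∀ v, MeasurableSet {ω | V ω = v} := fun v => hV (measurableSet_singleton v)
  have hkey := fun v hv => integrable_mul_and_integral_mul_of_condExp hm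
    ((integrable_const (1 : ℝ)).indicator (hset v)) (measurable_const.indicator (hset v))
    (fun ω => Set.indicator_nonneg (fun _ _ => zero_le_one) ω) ((hpm v hv).mono hm le_rfl)
    (hp0 v hv) (hlaw v hv) (hGm v) (hG0 v hv) (hGp v hv)
  have hdec : (fun ω => g ω * (V ω i / w ω)) = fun ω =>
      ∑ v ∈ S, g ω * (v i / w ω) * Set.indicator {ω | V ω = v} (fun _ => (1 : ℝ)) ω := by
    funext ω
    rw [Finset.sum_eq_single_of_mem (V ω) (hVS ω)]
    · simp
    · intro v _ hne
      simp [hne.symm]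
  rw [hdec]
  refine ⟨integrable_finsetSum _ fun v hv => (hkey v hv).1, ?_⟩
  rw [integral_finsetSum _ fun v hv => (hkey v hv).1,
    Finset.sum_congr rfl fun v hv => (hkey v hv).2, ← integral_finsetSum _ hGp]
  refine integral_congr_ae (ae_of_all _ fun ω => ?_)
  have h1 : ∀ v ∈ S, g ω * (v i / w ω) * p v ω = g ω / w ω * (p v ω * v i) := fun v _ => by ring
  simp only
  rw [Finset.sum_congr rfl h1, ← Finset.mul_sum, ← hw ω, div_mul_cancel₀ _ (hw0 ω).ne']

end ImportanceWeighting

/-! ### The regret bound -/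

section Regret

variable {d k n : ℕ} {S : Finset (Fin d → ℝ)} {Ω : Type*} {mΩ : MeasurableSpace Ω}
  {P : Measure Ω} {𝓖 : Filtration ℕ mΩ} {σ : SemiBanditForecaster S} {ℓ V : ℕ → Ω → Fin d → ℝ}

/-- This makes the weights `w_t` known before `V t` is drawn, as importance weighting requires. -/
theorem IsSemiBanditPlay.measurable_history (hplay : IsSemiBanditPlay P 𝓖 σ n ℓ V) {t : ℕ}
    (ht : t ≤ n) : Measurable[𝓖 t] (semiBanditHistory ℓ V t) := by
  let _ : MeasurableSpace Ω := 𝓖 t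
  refine measurable_pi_lambda _ fun s => ?_
  have hV : Measurable (V s) :=
    (hplay.action_measurable s (s.2.trans_le ht)).mono (𝓖.mono s.2) le_rfl
  have hl : Measurable (ℓ s) :=
    (hplay.loss_measurable s (s.2.trans_le ht)).mono (𝓖.mono s.2.le) le_rfl
  refine hV.prodMk (measurable_pi_lambda _ fun i => ?_)
  refine Measurable.ite ?_ ((measurable_pi_apply i).comp hl) measurable_const
  exact ((measurable_pi_apply i).comp hV) (measurableSet_singleton 1)

theorem IsSemiBanditPlay.isAdmissibleHistory (hplay : IsSemiBanditPlay P 𝓖 σ n ℓ V) {t : ℕ}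
    (ht : t ≤ n) (ω : Ω) : IsAdmissibleHistory S (semiBanditHistory ℓ V t ω) := fun s =>
  ⟨hplay.action_mem s (s.2.trans_le ht) ω,
    ℓ s ω, hplay.loss_nonneg s (s.2.trans_le ht) ω, rfl⟩

/-- Unobserved coordinates are multiplied by `v i = 0`, so the masking of `l` is harmless. -/
theorem semiBanditEstimate_obs (w l : Fin d → ℝ) {v : Fin d → ℝ} (i : Fin d)
    (hv : v i = 0 ∨ v i = 1) :
    semiBanditEstimate w (v, semiBanditObs l v) i = l i * (v i / w i) := by
  rcases hv with h | h <;> simp [semiBanditEstimate, semiBanditObs, h]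

/-- The pathwise regret bound of linexp, for the estimated losses. -/
theorem IsSemiBanditPlay.pathwise_bound (hplay : IsSemiBanditPlay P 𝓖 σ n ℓ V) (hn : 1 ≤ n)
    (hS : IsAlmostSymmetric S k) {η : ℝ} (hη : 0 < η) {w₁ : Fin d → ℝ} (hw₁ : ∀ i, 0 < w₁ i)
    (hσ : IsSemiBanditLinexp η w₁ n σ) {v : Fin d → ℝ} (hv : v ∈ S) (ω : Ω) :
    η * ∑ t ∈ range n, ℓ t ω ⬝ᵥ V t ω ≤
      η * (∑ t ∈ range n, ∑ i,
        ℓ t ω i * (V t ω i / σ.mean t (semiBanditHistory ℓ V t ω) i) * v i) +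
      genKL v w₁ + η ^ 2 / 2 * ∑ t ∈ range n, ∑ i,
        ℓ t ω i ^ 2 * (V t ω i / σ.mean t (semiBanditHistory ℓ V t ω) i) := by
  set w : ℕ → Fin d → ℝ := fun t => σ.mean t (semiBanditHistory ℓ V t ω) with hwdef
  set l : ℕ → Fin d → ℝ := fun t i => ℓ t ω i * (V t ω i / w t i) with hldef
  have hV01 : ∀ t < n, ∀ i, V t ω i = 0 ∨ V t ω i = 1 := fun t ht =>
    hS.1 _ (hplay.action_mem t ht ω)
  have hwpos : ∀ t < n, ∀ i, 0 < w t i := fun t ht =>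
    hσ.mean_pos hw₁ ht (hplay.isAdmissibleHistory ht.le ω)
  have hl0 : ∀ t < n, ∀ i, 0 ≤ l t i := fun t ht i =>
    mul_nonneg (hplay.loss_nonneg t ht ω i) (div_nonneg
      (by rcases hV01 t ht i with h | h <;> simp [h]) (hwpos t ht i).le)
  have hv0 := hS.convexHull_nonneg (subset_convexHull ℝ (S : Set (Fin d → ℝ)) hv)
  have hproj : ∀ t, t + 1 < n →
      genKL v (w (t + 1)) ≤ genKL v (fun i => w t i * Real.exp (-(η * l t i))) := by
    intro t ht
    have h := hσ.genKL_mean_succ_le hη hS hw₁ hv ht (hplay.isAdmissibleHistory ht.le ω)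
    have hest : l t = semiBanditEstimate (w t) (semiBanditHistory ℓ V (t + 1) ω (Fin.last t)) :=
      funext fun i => (semiBanditEstimate_obs _ _ i (hV01 t (Nat.lt_of_succ_lt ht) i)).symm
    rw [hest]
    exact h
  have hmain := multiplicative_regret_bound hη.le hv0 hn hwpos hl0 hproj
  have hw0 : w 0 = w₁ := hσ.1 _
  rw [hw0] at hmain
  have h1 : ∑ t ∈ range n, ∑ i, η * (l t i * (w t i - v i)) =
      η * ∑ t ∈ range n, ℓ t ω ⬝ᵥ V t ω - η * ∑ t ∈ range n, ∑ i, l t i * v i := by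
    rw [← mul_sub, ← Finset.sum_sub_distrib, Finset.mul_sum]
    refine Finset.sum_congr rfl fun t ht => ?_
    rw [dotProduct, ← Finset.sum_sub_distrib, Finset.mul_sum]
    refine Finset.sum_congr rfl fun i _ => ?_
    have := (hwpos t (Finset.mem_range.1 ht) i).ne'
    simp only [hldef]
    field_simp
  -- Since `V ^ 2 = V` coordinatewise, only one division by `w` survives.
  have h2 : ∑ t ∈ range n, ∑ i, η ^ 2 / 2 * (w t i * l t i ^ 2) =
      η ^ 2 / 2 * ∑ t ∈ range n, ∑ i, ℓ t ω i ^ 2 * (V t ω i / w t i) := by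
    rw [Finset.mul_sum]
    refine Finset.sum_congr rfl fun t ht => ?_
    rw [Finset.mul_sum]
    refine Finset.sum_congr rfl fun i _ => ?_
    have := (hwpos t (Finset.mem_range.1 ht) i).ne'
    simp only [hldef]
    rcases hV01 t (Finset.mem_range.1 ht) i with h | h
    · simp [h]
    · rw [h]; field_simp
  rw [h1, h2] at hmain
  linarith

theorem IsSemiBanditPlay.integral_importance_weighted [IsFiniteMeasure P]
    (hplay : IsSemiBanditPlay P 𝓖 σ n ℓ V) (hS : IsAlmostSymmetric S k) {η : ℝ}
    {w₁ : Fin d → ℝ} (hw₁ : ∀ i, 0 < w₁ i) (hσ : IsSemiBanditLinexp η w₁ n σ) {t : ℕ} (ht : t < n)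
    (i : Fin d) {C : ℝ} {g : Ω → ℝ} (hg : Measurable[𝓖 t] g) (hg0 : ∀ ω, 0 ≤ g ω)
    (hgC : ∀ ω, g ω ≤ C) :
    Integrable (fun ω => g ω * (V t ω i / σ.mean t (semiBanditHistory ℓ V t ω) i)) P ∧
      ∫ ω, g ω * (V t ω i / σ.mean t (semiBanditHistory ℓ V t ω) i) ∂P = ∫ ω, g ω ∂P :=
  integrable_and_integral_importance_weighted (𝓖.le t)
    (p := fun v ω => σ.prob t (semiBanditHistory ℓ V t ω) v)
    (fun _ hv => hS.convexHull_nonneg (subset_convexHull ℝ (S : Set (Fin d → ℝ)) hv) i)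
    ((hplay.action_measurable t ht).mono (𝓖.le (t + 1)) le_rfl) (hplay.action_mem t ht)
    (fun v hv => (σ.prob_measurable t v hv).comp (hplay.measurable_history ht.le))
    (fun v hv _ => σ.prob_nonneg t _ v hv) (hplay.action_law t ht) (fun _ => rfl)
    (fun ω => hσ.mean_pos hw₁ ht (hplay.isAdmissibleHistory ht.le ω) i) hg hg0 hgC

/-- The regret bound of linexp for losses in `[0, 1]` with bounded Euclidean norm. -/
theorem IsSemiBanditPlay.expectedRegret_le [IsProbabilityMeasure P]
    (hplay : IsSemiBanditPlay P 𝓖 σ n ℓ V) (hn : 1 ≤ n) (hS : IsAlmostSymmetric S k) {η : ℝ}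
    (hη : 0 < η) {w₁ : Fin d → ℝ}
    (harg : IsArgmin (fun w => bregman (linexpPotential η) w (fun _ => (k : ℝ) / (d : ℝ)))
      (convexHull ℝ (S : Set (Fin d → ℝ))) w₁)
    (hσ : IsSemiBanditLinexp η w₁ n σ) {B : ℝ} (h1 : ∀ t < n, ∀ ω i, ℓ t ω i ≤ 1)
    (hB : ∀ t < n, ∀ ω, ∑ i, ℓ t ω i ^ 2 ≤ B) :
    expectedRegret P S n ℓ V ≤
      k * max (Real.log ((d : ℝ) / k)) 1 / η + η * n * B / 2 := by
  have hk : (0 : ℝ) < k := by exact_mod_cast hS.2.1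
  have hd : (0 : ℝ) < d := by exact_mod_cast hS.2.1.trans hS.2.2.1
  have hy : ∀ _ : Fin d, (0 : ℝ) < (k : ℝ) / d := fun _ => by positivity
  have hw₁ := hS.pos_of_isArgmin hη hy harg
  set M := (k : ℝ) * max (Real.log ((d : ℝ) / k)) 1 with hM
  have : Nonempty {v // v ∈ S} := hS.nonempty.coe_sort
  have hlm : ∀ t < n, ∀ i, Measurable[𝓖 t] fun ω => ℓ t ω i := fun t ht i =>
    (measurable_pi_apply i).comp (hplay.loss_measurable t ht)
  have hVm : ∀ t < n, ∀ i, Measurable fun ω => V t ω i := fun t ht i =>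
    (measurable_pi_apply i).comp ((hplay.action_measurable t ht).mono (𝓖.le (t + 1)) le_rfl)
  have hli : ∀ t < n, ∀ i, Integrable (fun ω => ℓ t ω i) P := fun t ht i =>
    Integrable.of_bound ((hlm t ht i).mono (𝓖.le t) le_rfl).aestronglyMeasurable 1
      (ae_of_all _ fun ω => by
        rw [Real.norm_of_nonneg (hplay.loss_nonneg t ht ω i)]; exact h1 t ht ω i)
  have hl2i : ∀ t < n, ∀ i, Integrable (fun ω => ℓ t ω i ^ 2) P := fun t ht i =>
    Integrable.of_bound (((hlm t ht i).mono (𝓖.le t) le_rfl).pow_const 2).aestronglyMeasurable 1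
      (ae_of_all _ fun ω => by
        rw [Real.norm_of_nonneg (sq_nonneg _)]
        exact pow_le_one₀ (hplay.loss_nonneg t ht ω i) (h1 t ht ω i))
  have hplayed : Integrable (fun ω => ∑ t ∈ range n, ℓ t ω ⬝ᵥ V t ω) P := by
    refine integrable_finsetSum _ fun t ht => integrable_finsetSum _ fun i _ => ?_
    have ht := Finset.mem_range.1 ht
    refine (hli t ht i).mul_bdd (c := 1) (hVm t ht i).aestronglyMeasurable
      (ae_of_all _ fun ω => ?_)
    rcases hS.1 _ (hplay.action_mem t ht ω) i with h | h <;> simp [h]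
  have hIW1 := fun t (ht : t < n) i => hplay.integral_importance_weighted hS hw₁ hσ ht i
    (hlm t ht i) (fun ω => hplay.loss_nonneg t ht ω i) (fun ω => h1 t ht ω i)
  have hIW2 := fun t (ht : t < n) i => hplay.integral_importance_weighted hS hw₁ hσ ht i
    ((hlm t ht i).pow_const 2) (fun _ => sq_nonneg _)
    (fun ω => pow_le_one₀ (n := 2) (hplay.loss_nonneg t ht ω i) (h1 t ht ω i))
  have hcompare : ∀ v ∈ S, ∫ ω, ∑ t ∈ range n, ℓ t ω ⬝ᵥ V t ω ∂P - (M / η + η * n * B / 2) ≤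
      ∫ ω, ∑ t ∈ range n, ℓ t ω ⬝ᵥ v ∂P := by
    intro v hv
    have hKL : genKL v w₁ ≤ M := (hS.genKL_le_of_isArgmin hη hy hv harg).trans (hS.genKL_le hv)
    have hi1 : ∀ t ∈ range n, ∀ i ∈ (Finset.univ : Finset (Fin d)), Integrable (fun ω =>
        ℓ t ω i * (V t ω i / σ.mean t (semiBanditHistory ℓ V t ω) i) * v i) P :=
      fun t ht i _ => (hIW1 t (Finset.mem_range.1 ht) i).1.mul_const _
    have hi2 : ∀ t ∈ range n, ∀ i ∈ (Finset.univ : Finset (Fin d)), Integrable (fun ω =>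
        ℓ t ω i ^ 2 * (V t ω i / σ.mean t (semiBanditHistory ℓ V t ω) i)) P :=
      fun t ht i _ => (hIW2 t (Finset.mem_range.1 ht) i).1
    have hs1 := integrable_finsetSum _ fun t ht => integrable_finsetSum _ (hi1 t ht)
    have hs2 := integrable_finsetSum _ fun t ht => integrable_finsetSum _ (hi2 t ht)
    have hE1 : ∫ ω, ∑ t ∈ range n, ∑ i, ℓ t ω i *
        (V t ω i / σ.mean t (semiBanditHistory ℓ V t ω) i) * v i ∂P =
        ∫ ω, ∑ t ∈ range n, ℓ t ω ⬝ᵥ v ∂P := by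
      have hj : ∀ t ∈ range n, ∀ i ∈ (Finset.univ : Finset (Fin d)),
          Integrable (fun ω => ℓ t ω i * v i) P :=
        fun t ht i _ => (hli t (Finset.mem_range.1 ht) i).mul_const _
      simp only [dotProduct]
      rw [integral_finsetSum _ fun t ht => integrable_finsetSum _ (hi1 t ht),
        integral_finsetSum _ fun t ht => integrable_finsetSum _ (hj t ht)]
      refine Finset.sum_congr rfl fun t ht => ?_
      rw [integral_finsetSum _ (hi1 t ht), integral_finsetSum _ (hj t ht)]
      refine Finset.sum_congr rfl fun i _ => ?_
      rw [integral_mul_const, integral_mul_const, (hIW1 t (Finset.mem_range.1 ht) i).2]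
    have hE2 : ∫ ω, ∑ t ∈ range n, ∑ i, ℓ t ω i ^ 2 *
        (V t ω i / σ.mean t (semiBanditHistory ℓ V t ω) i) ∂P ≤ n * B := by
      rw [integral_finsetSum _ fun t ht => integrable_finsetSum _ (hi2 t ht)]
      have hterm : ∀ t ∈ range n, ∫ ω, ∑ i, ℓ t ω i ^ 2 *
          (V t ω i / σ.mean t (semiBanditHistory ℓ V t ω) i) ∂P ≤ B := by
        intro t ht
        have ht' := Finset.mem_range.1 ht
        rw [integral_finsetSum _ (hi2 t ht), Finset.sum_congr rfl fun i _ => (hIW2 t ht' i).2,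
          ← integral_finsetSum _ fun i _ => hl2i t ht' i]
        calc ∫ ω, ∑ i, ℓ t ω i ^ 2 ∂P ≤ ∫ _, B ∂P :=
              integral_mono (integrable_finsetSum _ fun i _ => hl2i t ht' i)
                (integrable_const B) (hB t ht')
          _ = B := by simp
      simpa using Finset.sum_le_sum hterm
    have hint := integral_mono (hplayed.const_mul η)
      (((hs1.const_mul η).add (integrable_const (genKL v w₁))).add (hs2.const_mul (η ^ 2 / 2)))
      (hplay.pathwise_bound hn hS hη hw₁ hσ hv)
    rw [integral_add' ((hs1.const_mul η).add (integrable_const _)) (hs2.const_mul _),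
      integral_add' (hs1.const_mul η) (integrable_const _), integral_const_mul,
      integral_const_mul, integral_const_mul, hE1, integral_const, probReal_univ, one_smul] at hint
    have hη2 : η ^ 2 / 2 * (∫ ω, ∑ t ∈ range n, ∑ i, ℓ t ω i ^ 2 *
        (V t ω i / σ.mean t (semiBanditHistory ℓ V t ω) i) ∂P) ≤ η ^ 2 / 2 * (n * B) :=
      mul_le_mul_of_nonneg_left hE2 (by positivity)
    refine le_of_mul_le_mul_left ?_ hη
    have hexp : η * (M / η + η * n * B / 2) = M + η ^ 2 / 2 * (n * B) := by field_simp
    rw [mul_sub, hexp]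
    linarith
  rw [expectedRegret, sub_le_comm]
  exact le_ciInf fun v => hcompare v v.2

end Regret

/-! ### Tuning of the parameter `η`. -/

theorem mainTheorem6 {d k n : ℕ} (hn : 1 ≤ n) (S : Finset (Fin d → ℝ))
    (hS : IsAlmostSymmetric S k) (L : ℝ) (hL : L = max (Real.log ((d : ℝ) / (k : ℝ))) 1)
    {Ω : Type*} {mΩ : MeasurableSpace Ω} (P : Measure Ω) [IsProbabilityMeasure P]
    (𝓖 : Filtration ℕ mΩ) (σ : SemiBanditForecaster S) (ℓ V : ℕ → Ω → Fin d → ℝ)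
    (hplay : IsSemiBanditPlay P 𝓖 σ n ℓ V) :
    (∀ (η : ℝ) (w₁ : Fin d → ℝ),
      η = √(2 * (k : ℝ) * L / ((n : ℝ) * (d : ℝ))) →
      IsArgmin (fun w => bregman (linexpPotential η) w (fun _ => (k : ℝ) / (d : ℝ)))
        (convexHull ℝ (S : Set (Fin d → ℝ))) w₁ →
      IsSemiBanditLinexp η w₁ n σ →
      LInftyAssumption n ℓ →
      expectedRegret P S n ℓ V ≤ √(2 * (k : ℝ) * (n : ℝ) * (d : ℝ) * L)) ∧
    (∀ (η : ℝ) (w₁ : Fin d → ℝ),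
      η = (k : ℝ) * √(L / ((n : ℝ) * (d : ℝ))) →
      IsArgmin (fun w => bregman (linexpPotential η) w (fun _ => (k : ℝ) / (d : ℝ)))
        (convexHull ℝ (S : Set (Fin d → ℝ))) w₁ →
      IsSemiBanditLinexp η w₁ n σ →
      LTwoAssumption S n ℓ →
      expectedRegret P S n ℓ V ≤ 2 * √((n : ℝ) * (d : ℝ) * L)) := by
  have hk : (0 : ℝ) < k := by exact_mod_cast hS.2.1
  have hd : (0 : ℝ) < d := by exact_mod_cast hS.2.1.trans hS.2.2.1
  have hn' : (0 : ℝ) < n := by exact_mod_cast hn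
  have hL0 : 0 < L := by rw [hL]; exact lt_of_lt_of_le one_pos (le_max_right _ _)
  refine ⟨fun η w₁ hη harg hσ hinf => ?_, fun η w₁ hη harg hσ htwo => ?_⟩
  · have hη0 : 0 < η := by rw [hη]; positivity
    have hl1 : ∀ t < n, ∀ ω i, ℓ t ω i ≤ 1 := fun t ht ω i =>
      (le_abs_self _).trans ((norm_le_pi_norm (ℓ t ω) i).trans (hinf t ht ω))
    have h := hplay.expectedRegret_le (B := d) hn hS hη0 harg hσ hl1 fun t ht ω => by
      refine (Finset.sum_le_sum fun i _ =>
        pow_le_one₀ (hplay.loss_nonneg t ht ω i) (hl1 t ht ω i)).trans ?_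
      simp
    rw [← hL] at h
    have hη2 : η ^ 2 = 2 * k * L / (n * d) := by rw [hη, Real.sq_sqrt (by positivity)]
    refine h.trans (Real.le_sqrt_of_sq_le (le_of_eq ?_))
    -- At this `η` both terms equal `η * n * d / 2`.
    have hsum : k * L / η + η * n * d / 2 = η * n * d := by
      have : k * L = η ^ 2 * n * d / 2 := by rw [hη2]; field_simp
      rw [this]; field_simp; norm_num
    rw [hsum, mul_pow, mul_pow, hη2]
    field_simp
  · have hη0 : 0 < η := by rw [hη]; positivity
    have h := hplay.expectedRegret_le (B := 2 * d / k) hn hS hη0 harg hσ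
      (fun t ht ω => hS.loss_le_one (hplay.loss_nonneg t ht ω) (htwo t ht ω))
      (fun t ht ω => hS.sum_sq_loss_le (hplay.loss_nonneg t ht ω) (htwo t ht ω))
    rw [← hL] at h
    set r := √(L / (n * d)) with hr
    have hr0 : 0 < r := by rw [hr]; positivity
    have hr2 : r ^ 2 = L / (n * d) := by rw [hr, Real.sq_sqrt (by positivity)]
    -- In terms of `r`, each of the two terms of the bound equals `n * d * r`.
    have hsqrt : √(n * d * L) = n * d * r := by
      rw [Real.sqrt_eq_iff_mul_self_eq (by positivity) (by positivity)]
      have : n * d * r * (n * d * r) = (n * d) ^ 2 * r ^ 2 := by ring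
      rw [this, hr2]; field_simp
    refine h.trans (le_of_eq ?_)
    have hLr : L = r ^ 2 * (n * d) := by rw [hr2]; field_simp
    rw [hsqrt, hη]
    nth_rewrite 1 [hLr]
    field_simp
    norm_num
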